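/- Let $T$ be the infinite binary rooted tree, whose vertices are the finite words over $\{0,1\}$, and let $\mathrm{Aut}\,T$ be its automorphism group. Write $g=\langle g_0,g_1\rangle\sigma^s$ for the automorphism with $g(xw)=\sigma^s(x)\,g_x(w)$ for every letter $x$ and word $w$, where $s\in\{0,1\}$ and $\sigma$ exchanges $0$ and $1$. For a word $w$ and $g\in\mathrm{Aut}\,T$ let $w*g$ be the automorphism that sends $wv$ to $w\,g(v)$ for every word $v$ and fixes every word that does not begin with $w$, and put $$\delta(g_1,\dots,g_n)=\prod_{i=0}^{n-1}\bigl(1^i0^{n-i}\bigr)*g_{i+1}$$ (the factors commute). Define the following elements of $\mathrm{Aut}\,T$: - $a=a_1=\sigma$ and $a_n=\langle 1,a_{n-1}\rangle\sigma$ for $n\ge 2$ (finite adding machines); - for $n\ge1$, $b_{(i,n)}=\langle 1,b_{(i+1,n)}\rangle$ for $1\le i<n$, and $b_{(n,n)}=\langle a,b_{(1,n)}\rangle$; - for $n\ge3$, $\tilde b_n=\delta(a,b_{(1,n-3)},\dots,b_{(n-3,n-3)},a_{n+1},\tilde b_{n+1})$. These recursions have unique solutions in $\mathrm{Aut}\,T$.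 For a subgroup $G\le\mathrm{Aut}\,T$ let $\mathrm{Stab}_G(m)$ be the subgroup of those elements of $G$ that fix every word of length $m$, and define the Hausdorff dimension of $G$ by $$\dim_H G=\liminf_{m\to\infty}\frac{\log|G/\mathrm{Stab}_G(m)|}{\log|\mathrm{Aut}\,T/\mathrm{Stab}_{\mathrm{Aut}\,T}(m)|}.$$ Then for every $n\ge3$ the group $H_n=\langle a_n,\tilde b_n\rangle$, generated by two elements, has Hausdorff dimension $\dim_H H_n=1$. -/

import Mathlib

namespace BinTree

/-- The automorphism group of the infinite binary rooted tree. The vertices are the finite words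
over `{0, 1}` (with `0 = false`, `1 = true`), the root is the empty word, and a word is below each
of its prefixes. An automorphism is a bijection of the vertices that preserves the level and the
prefix relation. -/
def autTree : Subgroup (Equiv.Perm (List Bool)) where
  carrier := {g | (∀ w, (g w).length = w.length) ∧ ∀ u v, g u <+: g v ↔ u <+: v}
  one_mem' := by simp
  mul_mem' := by
    rintro g h ⟨hg, hg'⟩ ⟨hh, hh'⟩
    exact ⟨fun w => by simp [hg, hh], fun u v => by simp [hg', hh']⟩
  inv_mem' := by
    rintro g ⟨hg, hg'⟩
    refine ⟨fun w => ?_, fun u v => ?_⟩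
    · simpa using (hg (g⁻¹ w)).symm
    · simpa using (hg' (g⁻¹ u) (g⁻¹ v)).symm

/-- The group `Aut T`. -/
abbrev AutT : Type := autTree

instance : CoeFun AutT (fun _ => List Bool → List Bool) := ⟨fun g => g.1⟩

theorem length_apply (g : AutT) (w : List Bool) : (g w).length = w.length := g.2.1 w

theorem prefix_apply (g : AutT) (u v : List Bool) : g u <+: g v ↔ u <+: v := g.2.2 u v

theorem mul_apply (g h : AutT) (w : List Bool) : (g * h) w = g (h w) := rfl

theorem one_apply (w : List Bool) : (1 : AutT) w = w := rfl

theorem ext_apply {g h : AutT} (H : ∀ w, g w = h w) : g = h := Subtype.ext (Equiv.ext H)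

theorem inv_apply_self (g : AutT) (w : List Bool) : g⁻¹ (g w) = w := g.1.symm_apply_apply w

theorem apply_inv_self (g : AutT) (w : List Bool) : g (g⁻¹ w) = w := g.1.apply_symm_apply w

/-- Underlying map of `⟨g₀, g₁⟩σ^s`. -/
def pairFun (g₀ g₁ : List Bool → List Bool) (s : Bool) : List Bool → List Bool
  | [] => []
  | false :: w => s :: g₀ w
  | true :: w => (!s) :: g₁ w

/-- The automorphism `⟨g₀, g₁⟩σ^s`: the word `0w` goes to `σ^s(0) g₀(w)` and `1w` goes to
`σ^s(1) g₁(w)`, where `σ` exchanges `0` and `1`. -/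
def pair (g₀ g₁ : AutT) (s : Bool) : AutT :=
  ⟨{ toFun := pairFun g₀ g₁ s
     invFun := pairFun (if s then ⇑g₁⁻¹ else ⇑g₀⁻¹) (if s then ⇑g₀⁻¹ else ⇑g₁⁻¹) s
     left_inv := by
      rintro (_ | ⟨_ | _, w⟩) <;> cases s <;> simp [pairFun]
     right_inv := by
      rintro (_ | ⟨_ | _, w⟩) <;> cases s <;> simp [pairFun] },
   by
    constructor
    · rintro (_ | ⟨_ | _, w⟩) <;> simp [pairFun, length_apply]
    · rintro (_ | ⟨_ | _, u⟩) (_ | ⟨_ | _, v⟩) <;> cases s <;>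
        simp [pairFun, prefix_apply, List.cons_prefix_cons]⟩

theorem pair_nil (g₀ g₁ : AutT) (s : Bool) : pair g₀ g₁ s [] = [] := rfl

theorem pair_false (g₀ g₁ : AutT) (s : Bool) (w : List Bool) :
    pair g₀ g₁ s (false :: w) = s :: g₀ w := rfl

theorem pair_true (g₀ g₁ : AutT) (s : Bool) (w : List Bool) :
    pair g₀ g₁ s (true :: w) = (!s) :: g₁ w := rfl

/-- The finite adding machines: `a 1 = σ` and `a (n + 1) = ⟨1, a n⟩σ`. -/
def a : ℕ → AutT
  | 0 => 1
  | n + 1 => pair 1 (a n) true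

/-- `star w g` is `w * g`: it acts as `g` on the subtree of words that begin with `w` and trivially
everywhere else. -/
def star : List Bool → AutT → AutT
  | [], g => g
  | false :: w, g => pair (star w g) 1 false
  | true :: w, g => pair 1 (star w g) false

/-- `δ(g₁, …, gₙ) = ∏_{i = 0}^{n - 1} (1^i 0^{n - i}) * g_{i + 1}`. The factors commute. -/
def delta (gs : List AutT) : AutT :=
  (gs.mapIdx fun i g =>
    star (List.replicate i true ++ List.replicate (gs.length - i) false) g).prod

/-! Limits of sequences of automorphisms, used to solve the recursions below. -/

/-- `g` and `h` agree on the first `d` levels. -/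
def Agree (d : ℕ) (g h : AutT) : Prop := ∀ w : List Bool, w.length ≤ d → g w = h w

theorem Agree.mono {d e : ℕ} {g h : AutT} (H : Agree e g h) (hde : d ≤ e) : Agree d g h :=
  fun w hw => H w (hw.trans hde)

theorem Agree.pair {d : ℕ} {g₀ g₁ h₀ h₁ : AutT} (H₀ : Agree d g₀ h₀) (H₁ : Agree d g₁ h₁)
    (s : Bool) : Agree (d + 1) (pair g₀ g₁ s) (pair h₀ h₁ s) := by
  rintro (_ | ⟨_ | _, w⟩) hw
  · rfl
  · rw [pair_false, pair_false, H₀ w (by simpa using hw)]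
  · rw [pair_true, pair_true, H₁ w (by simpa using hw)]

theorem Agree.star {d : ℕ} {g h : AutT} (H : Agree d g h) :
    ∀ w : List Bool, Agree (d + w.length) (star w g) (star w h)
  | [] => H
  | false :: w => (H.star w).pair (fun _ _ => rfl) false
  | true :: w => Agree.pair (fun _ _ => rfl) (H.star w) false

theorem Agree.delta {d : ℕ} {g h : AutT} (H : Agree d g h) (l : List AutT) :
    Agree (d + 1) (delta (l ++ [g])) (delta (l ++ [h])) := by
  intro w hw
  have hs := H.star (List.replicate l.length true ++ List.replicate (l.length + 1 - l.length) false)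
  have := hs w (by simp; omega)
  simp only [BinTree.delta, List.mapIdx_append, List.prod_append, List.length_append,
    List.length_singleton, mul_apply, List.mapIdx_cons, List.mapIdx_nil, List.prod_singleton,
    zero_add]
  rw [this]

theorem Agree.of_step {f : ℕ → AutT} (hf : ∀ d, Agree d (f d) (f (d + 1))) {d e : ℕ}
    (hde : d ≤ e) : Agree d (f d) (f e) := by
  induction e, hde using Nat.le_induction with
  | base => exact fun _ _ => rfl
  | succ e hde ih => exact fun w hw => (ih w hw).trans (hf e w (hw.trans hde))

/-- The limit of a sequence of automorphisms whose `d`-th and `(d + 1)`-st terms agree on the first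
`d` levels: on words of length `d` it is the `d`-th term. -/
def limit (f : ℕ → AutT) (hf : ∀ d, Agree d (f d) (f (d + 1))) : AutT :=
  ⟨{ toFun := fun w => f w.length w
     invFun := fun w => (f w.length)⁻¹ w
     left_inv := fun w => by
      simp only [length_apply, inv_apply_self]
     right_inv := fun w => by
      simp only [length_apply, apply_inv_self] },
   by
    refine ⟨fun w => length_apply _ w, fun u v => ?_⟩
    have h : ∀ u v : List Bool, u.length ≤ v.length →
        f u.length u = f v.length u := fun u v huv => Agree.of_step hf huv u le_rfl
    change f u.length u <+: f v.length v ↔ u <+: v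
    rcases le_total u.length v.length with huv | huv
    · rw [h u v huv, prefix_apply]
    · rw [h v u huv, prefix_apply]⟩

theorem limit_apply (f : ℕ → AutT) (hf : ∀ d, Agree d (f d) (f (d + 1))) (w : List Bool) :
    limit f hf w = f w.length w := rfl

theorem limit_agree (f : ℕ → AutT) (hf : ∀ d, Agree d (f d) (f (d + 1))) (d : ℕ) :
    Agree d (limit f hf) (f d) :=
  fun w hw => Agree.of_step hf hw w le_rfl

/-- Two automorphisms that agree on all levels with a common sequence are equal. -/
theorem eq_of_agree {g h : AutT} (H : ∀ d, Agree (d + 1) g h) : g = h :=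
  ext_apply fun w => H w.length w (Nat.le_succ _)

/-! The generators of the spinal groups. -/

/-- Approximations of `b_{(i, n)}`. -/
def bAux (n : ℕ) : ℕ → ℕ → AutT
  | 0, _ => 1
  | d + 1, i => if i = n then pair (a 1) (bAux n d 1) false else pair 1 (bAux n d (i + 1)) false

theorem bAux_agree (n : ℕ) (d i : ℕ) : Agree d (bAux n d i) (bAux n (d + 1) i) := by
  induction d generalizing i with
  | zero =>
    intro w hw
    obtain rfl : w = [] := by simpa using hw
    have := length_apply (bAux n 1 i) []
    exact (List.length_eq_zero_iff.1 this).symm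
  | succ d ih =>
    rw [bAux, bAux]
    split_ifs
    · exact Agree.pair (fun _ _ => rfl) (ih _) false
    · exact Agree.pair (fun _ _ => rfl) (ih _) false

/-- The automorphism `b_{(i, n)}` (for `1 ≤ i ≤ n`), determined by `b_rec` and `b_rec_last`. -/
def b (i n : ℕ) : AutT := limit (fun d => bAux n d i) (fun d => bAux_agree n d i)

theorem b_rec {i n : ℕ} (h : i < n) : b i n = pair 1 (b (i + 1) n) false := by
  refine eq_of_agree fun d w hw => ?_
  have h₁ := limit_agree _ (fun d => bAux_agree n d i) (d + 1) w hw
  have h₂ := limit_agree _ (fun d => bAux_agree n d (i + 1)) d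
  rw [b, h₁, bAux, if_neg h.ne]
  exact (Agree.pair (fun _ _ => rfl) h₂ false w hw).symm

theorem b_rec_last (n : ℕ) : b n n = pair (a 1) (b 1 n) false := by
  refine eq_of_agree fun d w hw => ?_
  have h₁ := limit_agree _ (fun d => bAux_agree n d n) (d + 1) w hw
  have h₂ := limit_agree _ (fun d => bAux_agree n d 1) d
  rw [b, h₁, bAux, if_pos rfl]
  exact (Agree.pair (fun _ _ => rfl) h₂ false w hw).symm

/-! The second generator of the group `H_n`. -/

/-- The list `a, b_{(1, n - 3)}, …, b_{(n - 3, n - 3)}, a_{n + 1}`. It has `n - 1` entries if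
`n ≥ 3`. -/
def initArgs (n : ℕ) : List AutT :=
  a 1 :: ((List.range (n - 3)).map fun i => b (i + 1) (n - 3)) ++ [a (n + 1)]

/-- Approximations of `b̃_n`. -/
def bTildeAux : ℕ → ℕ → AutT
  | 0, _ => 1
  | d + 1, n => delta (initArgs n ++ [bTildeAux d (n + 1)])

theorem bTildeAux_agree (d n : ℕ) : Agree d (bTildeAux d n) (bTildeAux (d + 1) n) := by
  induction d generalizing n with
  | zero =>
    intro w hw
    obtain rfl : w = [] := by simpa using hw
    have := length_apply (bTildeAux 1 n) []
    exact (List.length_eq_zero_iff.1 this).symm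
  | succ d ih =>
    rw [bTildeAux, bTildeAux]
    exact (ih (n + 1)).delta (initArgs n)

/-- The automorphism `b̃_n` (for `n ≥ 3`), determined by the recursion `bTilde_rec`. -/
def bTilde (n : ℕ) : AutT := limit (fun d => bTildeAux d n) (fun d => bTildeAux_agree d n)

/-- `b̃_n = δ(a, b_{(1, n - 3)}, …, b_{(n - 3, n - 3)}, a_{n + 1}, b̃_{n + 1})`. -/
theorem bTilde_rec (n : ℕ) : bTilde n = delta (initArgs n ++ [bTilde (n + 1)]) := by
  refine eq_of_agree fun d w hw => ?_
  have h₁ := limit_agree _ (fun d => bTildeAux_agree d n) (d + 1) w hw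
  have h₂ := limit_agree _ (fun d => bTildeAux_agree d (n + 1)) d
  rw [bTilde, h₁, bTildeAux]
  exact (Agree.delta h₂ (initArgs n) w hw).symm

/-- The group `H_n`, generated by `a_n` and `b̃_n`. -/
def H (n : ℕ) : Subgroup AutT := Subgroup.closure {a n, bTilde n}

/-! Hausdorff dimension. -/

/-- The fixator of the `m`-th level in `Aut T`. -/
def stab (m : ℕ) : Subgroup AutT where
  carrier := {g | ∀ w : List Bool, w.length = m → g w = w}
  one_mem' := fun _ _ => rfl
  mul_mem' := by
    intro g h hg hh w hw
    rw [mul_apply, hh w hw, hg w hw]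
  inv_mem' := by
    intro g hg w hw
    have := inv_apply_self g w
    rwa [hg w hw] at this

/-- The Hausdorff dimension of a subgroup `G` of `Aut T`:
`liminf_m log |G mod m| / log |Aut T mod m|`, where `G mod m = G / Stab_G(m)`. -/
noncomputable def hausdorffDim (G : Subgroup AutT) : ℝ :=
  Filter.liminf (fun m : ℕ => Real.log (Nat.card (G ⧸ (stab m).subgroupOf G)) /
    Real.log (Nat.card (AutT ⧸ stab m))) Filter.atTop

end BinTree

/-! Write d(G, m) for the binary logarithm of the order of G on level m, divided by 2^m. For Aut T
this is 1 - 2^(-m), so the claim is that d(H_n, m) tends to 1.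

The engine is a commutator trick. Powers of a_n translate level n cyclically with trivial sections
there. Numbering level n in binary, δ(g_1, …, g_n) has its nontrivial sections only at vertices
numbered 2^i - 1, and these numbers have distinct differences modulo 2^n. Hence δ and a suitable
translate of it meet at only one vertex, and their commutator is a copy of [g_j, g_i] at that
vertex. So G = ⟨a_n, δ(g_1, …, g_n)⟩ contains at every vertex of level n a copy of a subgroup L of K
= ⟨g_1, …, g_n⟩ with K/L abelian. The n generators of K/L have order at most 2^m on level m, whence
d(G, m + n) ≥ d(K, m) - nm/2^m (`stab_relIndex_closure_delta`, `density_add_ge`).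

For G = H_n, K contains both H_{n+1} and the spinal group on a and the b_{(i, n-3)}. The error
vanishes as m grows, so the lower density of H_n is at least that of H_{n+j} for every j, hence at
least that of the spinal group with parameter N for all large N. That group acts as all of Aut T on
the first N + 1 levels (`spinal_level`) and afterwards loses at most 2m/2^m in density at step m
(`spinal_relIndex_succ`). Its lower density is therefore at least 1 - (4N + 9)/2^(N+1), which tends
to 1. -/

namespace BinTree

/-! Sections of automorphisms. -/

/-- `g` maps the subtree at `u` to the subtree at `v`, acting between them as `y`. -/
def Sec (g : AutT) (u v : List Bool) (y : AutT) : Prop := ∀ w, g (u ++ w) = v ++ y w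

theorem Sec.one (u : List Bool) : Sec 1 u u 1 := fun _ => rfl

theorem Sec.mul {g h : AutT} {u v z : List Bool} {x y : AutT} (hg : Sec g v z x)
    (hh : Sec h u v y) : Sec (g * h) u z (x * y) := fun w => by
  rw [mul_apply, hh, hg, mul_apply]

theorem Sec.inv {g : AutT} {u v : List Bool} {y : AutT} (hg : Sec g u v y) :
    Sec g⁻¹ v u y⁻¹ := fun w => by
  have := hg (y⁻¹ w)
  rw [apply_inv_self] at this
  rw [← this, inv_apply_self]

theorem apply_nil (g : AutT) : g [] = [] := List.length_eq_zero_iff.1 (length_apply g [])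

theorem Sec.apply {g : AutT} {u v : List Bool} {y : AutT} (hg : Sec g u v y) : g u = v := by
  simpa [apply_nil] using hg []

theorem Sec.length {g : AutT} {u v : List Bool} {y : AutT} (hg : Sec g u v y) :
    v.length = u.length := by
  rw [← hg.apply, length_apply]

theorem Sec.pair_false {g₀ g₁ y : AutT} {u v : List Bool} (h : Sec g₀ u v y) (s : Bool) :
    Sec (pair g₀ g₁ s) (false :: u) (s :: v) y := fun w => by
  rw [List.cons_append, BinTree.pair_false, h, List.cons_append]

theorem Sec.pair_true {g₀ g₁ y : AutT} {u v : List Bool} (h : Sec g₁ u v y) (s : Bool) :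
    Sec (pair g₀ g₁ s) (true :: u) ((!s) :: v) y := fun w => by
  rw [List.cons_append, BinTree.pair_true, h, List.cons_append]

/-- Automorphisms that agree on long words are equal. -/
theorem ext_of_length_le {g h : AutT} (n : ℕ) (H : ∀ w, n ≤ w.length → g w = h w) : g = h := by
  refine ext_apply fun w => ?_
  have h1 := (prefix_apply g w (w ++ List.replicate n false)).2 (List.prefix_append _ _)
  have h2 := (prefix_apply h w (w ++ List.replicate n false)).2 (List.prefix_append _ _)
  rw [H (w ++ List.replicate n false) (by simp)] at h1
  exact (List.prefix_of_prefix_length_le h1 h2 (by simp [length_apply])).eq_of_length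
    (by simp [length_apply])

theorem exists_append {n : ℕ} {w : List Bool} (h : n ≤ w.length) :
    ∃ u v, u.length = n ∧ w = u ++ v :=
  ⟨w.take n, w.drop n, by simp [h], by simp⟩

theorem ext_of_sec {g h : AutT} (n : ℕ)
    (H : ∀ u : List Bool, u.length = n → ∃ v y, Sec g u v y ∧ Sec h u v y) : g = h := by
  refine ext_of_length_le n fun w hw => ?_
  obtain ⟨u, z, hu, rfl⟩ := exists_append hw
  obtain ⟨v, y, hg, hh⟩ := H u hu
  rw [hg, hh]

theorem pair_one : pair 1 1 false = 1 := by
  refine ext_apply fun w => ?_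
  rcases w with _ | ⟨_ | _, w⟩ <;> rfl

theorem pair_mul (g₀ g₁ h₀ h₁ : AutT) :
    pair g₀ g₁ false * pair h₀ h₁ false = pair (g₀ * h₀) (g₁ * h₁) false := by
  refine ext_apply fun w => ?_
  rcases w with _ | ⟨_ | _, w⟩ <;> rfl

/-- The embedding of `Aut T × Aut T` as the stabilizer of the first level. -/
def pairHom : AutT × AutT →* AutT where
  toFun p := pair p.1 p.2 false
  map_one' := pair_one
  map_mul' p q := (pair_mul p.1 p.2 q.1 q.2).symm

theorem apply_cons_of_fix {g : AutT} {x : Bool} (hx : g [x] = [x]) (w : List Bool) :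
    ∃ v, g (x :: w) = x :: v := by
  have h := (prefix_apply g [x] (x :: w)).2 (by simp)
  rw [hx] at h
  obtain ⟨v, hv⟩ := h
  exact ⟨v, by rw [← hv]; rfl⟩

/-- The section of `g` at a fixed vertex of the first level. -/
theorem exists_sec_of_fix {g : AutT} {x : Bool} (hx : g [x] = [x]) : ∃ y, Sec g [x] [x] y := by
  have hx' : g⁻¹ [x] = [x] := by
    conv_lhs => rw [← hx]
    exact inv_apply_self _ _
  have h1 : ∀ w, g (x :: w) = x :: (g (x :: w)).tail := fun w => by
    obtain ⟨v, hv⟩ := apply_cons_of_fix hx w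
    rw [hv]; rfl
  have h2 : ∀ w, g⁻¹ (x :: w) = x :: (g⁻¹ (x :: w)).tail := fun w => by
    obtain ⟨v, hv⟩ := apply_cons_of_fix hx' w
    rw [hv]; rfl
  refine ⟨⟨{ toFun := fun w => (g (x :: w)).tail
             invFun := fun w => (g⁻¹ (x :: w)).tail
             left_inv := fun w => ?_
             right_inv := fun w => ?_ }, ?_, ?_⟩, fun w => h1 w⟩
  · dsimp only
    rw [← h1, inv_apply_self, List.tail_cons]
  · dsimp only
    rw [← h2, apply_inv_self, List.tail_cons]
  · intro w
    simp [length_apply]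
  · intro u v
    have := prefix_apply g (x :: u) (x :: v)
    rw [h1 u, h1 v] at this
    simpa using this

theorem a_one_mul_self : a 1 * a 1 = 1 := by
  refine ext_apply fun w => ?_
  rcases w with _ | ⟨_ | _, w⟩ <;> rfl

theorem apply_singleton (g : AutT) :
    (∀ x, g [x] = [x]) ∨ (∀ x, g [x] = [!x]) := by
  have h : ∀ x, ∃ y, g [x] = [y] := fun x =>
    List.length_eq_one_iff.1 (length_apply g [x])
  obtain ⟨y, hy⟩ := h false
  obtain ⟨z, hz⟩ := h true
  have hyz : y ≠ z := by
    rintro rfl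
    have := congrArg (fun w => g⁻¹ w) (hy.trans hz.symm)
    simp only [inv_apply_self] at this
    simp at this
  cases y <;> cases z <;> simp_all

theorem exists_pair_of_fix {g : AutT} (h : ∀ x, g [x] = [x]) :
    ∃ g₀ g₁, g = pair g₀ g₁ false := by
  obtain ⟨g₀, h₀⟩ := exists_sec_of_fix (h false)
  obtain ⟨g₁, h₁⟩ := exists_sec_of_fix (h true)
  refine ⟨g₀, g₁, ext_apply fun w => ?_⟩
  rcases w with _ | ⟨_ | _, w⟩
  · exact apply_nil g
  · exact h₀ w
  · exact h₁ w

/-- Every automorphism has a section at every vertex. -/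
theorem exists_sec (u : List Bool) : ∀ g : AutT, ∃ y, Sec g u (g u) y := by
  suffices H : ∀ g : AutT, ∃ v y, Sec g u v y by
    intro g
    obtain ⟨v, y, h⟩ := H g
    exact ⟨y, by rwa [h.apply]⟩
  induction u with
  | nil => exact fun g => ⟨[], g, fun _ => rfl⟩
  | cons x u ih =>
    have key : ∀ g : AutT, (∀ x, g [x] = [x]) → ∃ v y, Sec g (x :: u) v y := by
      intro g hg
      obtain ⟨g₀, g₁, rfl⟩ := exists_pair_of_fix hg
      cases x
      · obtain ⟨v, y, h⟩ := ih g₀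
        exact ⟨_, y, h.pair_false false⟩
      · obtain ⟨v, y, h⟩ := ih g₁
        exact ⟨_, y, h.pair_true false⟩
    intro g
    rcases apply_singleton g with hg | hg
    · exact key g hg
    -- Composing with the swap `a 1` reduces to an automorphism that fixes the first level; the swap
    -- is undone afterwards.
    · obtain ⟨v, y, h⟩ := key (a 1 * g) fun x => by
        rw [mul_apply, hg]; cases x <;> rfl
      rcases v with _ | ⟨s, v⟩
      · simpa using h.length
      refine ⟨(!s) :: v, y, fun w => ?_⟩
      have := h w
      rw [mul_apply] at this
      have := congrArg (fun z => (a 1) z) this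
      rw [← mul_apply, a_one_mul_self, one_apply] at this
      rw [this]
      cases s <;> rfl

theorem star_append (u : List Bool) (g : AutT) : Sec (star u g) u u g := by
  induction u with
  | nil => exact fun _ => rfl
  | cons x u ih =>
    cases x
    · exact ih.pair_false false
    · exact ih.pair_true false

theorem star_of_ne {u v : List Bool} (g : AutT) (hl : u.length = v.length) (h : v ≠ u) :
    Sec (star u g) v v 1 := by
  induction u generalizing v with
  | nil => exact absurd (List.length_eq_zero_iff.1 hl.symm) h
  | cons x u ih =>
    rcases v with _ | ⟨y, v⟩
    · simp at hl
    have hl' : u.length = v.length := by simpa using hl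
    cases x <;> cases y
    · exact (ih hl' (by simpa using h)).pair_false false
    · exact Sec.pair_true (Sec.one v) false
    · exact Sec.pair_false (Sec.one v) false
    · exact (ih hl' (by simpa using h)).pair_true false

theorem star_mul (u : List Bool) (g h : AutT) : star u (g * h) = star u g * star u h := by
  induction u with
  | nil => rfl
  | cons x u ih => cases x <;> simp [star, ih, pair_mul]

theorem star_one (u : List Bool) : star u 1 = 1 := by
  induction u with
  | nil => rfl
  | cons x u ih => cases x <;> simp [star, ih, pair_one]

/-- `star u` as a homomorphism. -/
def starHom (u : List Bool) : AutT →* AutT where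
  toFun := star u
  map_one' := star_one u
  map_mul' := star_mul u

/-- Conjugation moves the support from the subtree at `u` to that at `v`; all later transport of
copies between vertices rests on this. -/
theorem conj_star {g : AutT} {u v : List Bool} {y : AutT} (hg : Sec g u v y) (x : AutT) :
    g * star u x * g⁻¹ = star v (y * x * y⁻¹) := by
  refine ext_of_sec u.length fun z hz => ?_
  by_cases hzv : z = v
  · subst hzv
    exact ⟨z, _, (hg.mul (star_append u x)).mul hg.inv, star_append _ _⟩
  · obtain ⟨t, ht⟩ := exists_sec z g⁻¹
    have hne : g⁻¹ z ≠ u := fun h => hzv (by rw [← hg.apply, ← h, apply_inv_self])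
    have h1 := star_of_ne x (by rw [length_apply, hz]) hne
    have h2 := (ht.inv.mul h1).mul ht
    rw [inv_inv, mul_one, inv_mul_cancel] at h2
    exact ⟨z, 1, h2, star_of_ne _ (hg.length.trans hz.symm) hzv⟩

/-! Counting modulo a level. -/

instance stab_normal (m : ℕ) : (stab m).Normal where
  conj_mem := by
    intro g hg h w hw
    rw [mul_apply, mul_apply, hg _ (by rw [length_apply, hw]), apply_inv_self]

theorem stab_zero : stab 0 = ⊤ := by
  refine eq_top_iff.2 fun g _ w hw => ?_
  rw [List.length_eq_zero_iff.1 hw, apply_nil]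

theorem stab_anti {m n : ℕ} (h : m ≤ n) : stab n ≤ stab m := by
  intro g hg w hw
  have h1 := (prefix_apply g w (w ++ List.replicate (n - m) false)).2 (List.prefix_append _ _)
  rw [hg (w ++ List.replicate (n - m) false) (by simp [hw]; omega)] at h1
  exact ((List.prefix_of_prefix_length_le h1 (List.prefix_append _ _)
    (by simp [length_apply]))).eq_of_length (by simp [length_apply])

theorem stab_one_index : (stab 1).index = 2 := by
  refine Subgroup.index_eq_two_iff.2 ⟨a 1, fun g => ?_⟩
  have hmem : ∀ h : AutT, h ∈ stab 1 ↔ ∀ x, h [x] = [x] := by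
    refine fun h => ⟨fun H x => H [x] rfl, fun H w hw => ?_⟩
    obtain ⟨x, rfl⟩ := List.length_eq_one_iff.1 hw
    exact H x
  have ha : ∀ x, a 1 [x] = [!x] := by rintro (_ | _) <;> rfl
  rcases apply_singleton g with h | h
  · refine Or.inr ⟨(hmem g).2 h, fun H => ?_⟩
    have := (hmem _).1 H false
    rw [mul_apply, ha, h] at this
    simp at this
  · refine Or.inl ⟨(hmem _).2 fun x => by rw [mul_apply, ha, h, Bool.not_not], fun H => ?_⟩
    have := (hmem _).1 H false
    rw [h] at this
    simp at this

theorem comap_pairHom_stab (m : ℕ) :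
    (stab (m + 1)).comap pairHom = (stab m).prod (stab m) := by
  ext ⟨g₀, g₁⟩
  rw [Subgroup.mem_comap, Subgroup.mem_prod]
  change (∀ w : List Bool, w.length = m + 1 → pair g₀ g₁ false w = w) ↔
    (∀ w : List Bool, w.length = m → g₀ w = w) ∧ (∀ w : List Bool, w.length = m → g₁ w = w)
  constructor
  · intro h
    refine ⟨fun w hw => ?_, fun w hw => ?_⟩
    · simpa [pair_false] using h (false :: w) (by simpa using hw)
    · simpa [pair_true] using h (true :: w) (by simpa using hw)
  · rintro ⟨h₀, h₁⟩ w hw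
    rcases w with _ | ⟨_ | _, w⟩
    · simp at hw
    · rw [pair_false, h₀ w (by simpa using hw)]
    · rw [pair_true, h₁ w (by simpa using hw), Bool.not_false]

theorem map_pairHom_top : (⊤ : Subgroup (AutT × AutT)).map pairHom = stab 1 := by
  refine le_antisymm ?_ fun g hg => ?_
  · rintro _ ⟨⟨g₀, g₁⟩, -, rfl⟩ w hw
    obtain ⟨x, rfl⟩ := List.length_eq_one_iff.1 hw
    cases x
    · exact congrArg _ (apply_nil g₀)
    · exact congrArg _ (apply_nil g₁)
  · obtain ⟨g₀, g₁, rfl⟩ := exists_pair_of_fix fun x => hg [x] rfl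
    exact ⟨(g₀, g₁), trivial, rfl⟩

theorem stab_index (m : ℕ) : (stab m).index = 2 ^ (2 ^ m - 1) := by
  induction m with
  | zero => simp [stab_zero]
  | succ m ih =>
    -- The first-level stabilizer is Aut T × Aut T, and level `m + 1` of it is level `m` of each
    -- factor.
    rw [← Subgroup.relIndex_mul_index (stab_anti (show 1 ≤ m + 1 by omega)), stab_one_index,
      ← map_pairHom_top, ← Subgroup.relIndex_comap, comap_pairHom_stab, Subgroup.relIndex_top_right,
      Subgroup.index_prod, ih, ← pow_add, ← pow_succ]
    congr 1
    have := Nat.one_le_two_pow (n := m)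
    rw [pow_succ]
    omega

theorem stab_relIndex_ne_zero (m : ℕ) (G : Subgroup AutT) : (stab m).relIndex G ≠ 0 := fun h =>
  absurd (Subgroup.index_eq_zero_of_relIndex_eq_zero h) (by rw [stab_index]; positivity)

theorem stab_relIndex_mono (m : ℕ) {G K : Subgroup AutT} (h : G ≤ K) :
    (stab m).relIndex G ≤ (stab m).relIndex K :=
  Subgroup.relIndex_le_of_le_right h (stab_relIndex_ne_zero m K)

theorem stab_relIndex_le (m : ℕ) (G : Subgroup AutT) :
    (stab m).relIndex G ≤ 2 ^ (2 ^ m - 1) := by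
  rw [← stab_index, ← Subgroup.relIndex_top_right]
  exact stab_relIndex_mono m le_top

theorem relIndex_prod {G G' : Type*} [Group G] [Group G'] (A C : Subgroup G) (B D : Subgroup G') :
    (A.prod B).relIndex (C.prod D) = A.relIndex C * B.relIndex D := by
  have h1 : (C.subtype.prodMap D.subtype).range = C.prod D := by
    ext ⟨x, y⟩
    simp [Subgroup.mem_prod]
  have h2 : (A.prod B).comap (C.subtype.prodMap D.subtype) =
      (A.subgroupOf C).prod (B.subgroupOf D) := by
    ext ⟨x, y⟩
    simp [Subgroup.mem_prod, Subgroup.mem_subgroupOf]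
  rw [← h1, ← Subgroup.index_comap, h2, Subgroup.index_prod]
  rfl

theorem stab_relIndex_mul_le {m : ℕ} {G L₀ L₁ : Subgroup AutT}
    (h₀ : ∀ x ∈ L₀, star [false] x ∈ G) (h₁ : ∀ x ∈ L₁, star [true] x ∈ G) :
    (stab m).relIndex L₀ * (stab m).relIndex L₁ ≤ (stab (m + 1)).relIndex G := by
  rw [← relIndex_prod, ← comap_pairHom_stab, Subgroup.relIndex_comap]
  refine stab_relIndex_mono _ ?_
  rintro _ ⟨⟨x, y⟩, ⟨hx, hy⟩, rfl⟩
  have : pairHom (x, y) = star [false] x * star [true] y := by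
    change _ = pair x 1 false * pair 1 y false
    rw [pair_mul, mul_one, one_mul]
    rfl
  rw [this]
  exact mul_mem (h₀ x hx) (h₁ y hy)

/-- If `G` contains a copy of `L` at every vertex of level `n`, it contains their product. -/
theorem stab_relIndex_pow_le {m n : ℕ} {G L : Subgroup AutT}
    (h : ∀ u : List Bool, u.length = n → ∀ x ∈ L, star u x ∈ G) :
    (stab m).relIndex L ^ 2 ^ n ≤ (stab (m + n)).relIndex G := by
  induction n generalizing G with
  | zero => simpa using stab_relIndex_mono m fun x hx => h [] rfl x hx
  | succ n ih =>
    have := stab_relIndex_mul_le (m := m + n) (G := G) (L₀ := G.comap (starHom [false]))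
      (L₁ := G.comap (starHom [true])) (fun _ h => h) (fun _ h => h)
    refine le_trans ?_ this
    rw [pow_succ, pow_mul, sq]
    exact Nat.mul_le_mul
      (ih fun u hu x hx => h (false :: u) (by simpa using hu) x hx)
      (ih fun u hu x hx => h (true :: u) (by simpa using hu) x hx)

/-- The square of any section fixes the first level. By iteration, the exponent of Aut T on level
`m` divides 2^m. -/
theorem sq_mem_stab {m : ℕ} {g : AutT} (hg : g ∈ stab m) : g ^ 2 ∈ stab (m + 1) := by
  intro w hw
  obtain ⟨u, v, hu, rfl⟩ := exists_append (n := m) (w := w) (by omega)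
  obtain ⟨y, hy⟩ := exists_sec u g
  rw [hg u hu] at hy
  rw [pow_two, mul_apply, hy, hy]
  have hv : v.length = 1 := by simp at hw; omega
  obtain ⟨x, rfl⟩ := List.length_eq_one_iff.1 hv
  rcases apply_singleton y with h | h <;> simp [h]

theorem pow_mem_stab (g : AutT) (m : ℕ) : g ^ 2 ^ m ∈ stab m := by
  induction m with
  | zero => simp [stab_zero]
  | succ m ih =>
    rw [pow_succ, pow_mul]
    exact sq_mem_stab ih

open scoped Pointwise in
theorem card_sup_zpowers_le {Q : Type*} [Group Q] (N : Subgroup Q) [Finite N] {s : Q} {k : ℕ}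
    (hk : 0 < k) (hs : s ^ k = 1) (h : ∀ x ∈ N, s * x * s⁻¹ ∈ N) :
    Nat.card ↥(N ⊔ Subgroup.zpowers s) ≤ Nat.card N * k := by
  have hn : s ∈ Subgroup.normalizer (N : Set Q) := by
    -- One inclusion suffices for normalizing because `N` is finite.
    have hmap : N.map (MulAut.conj s).toMonoidHom ≤ N := by
      rintro _ ⟨x, hx, rfl⟩
      exact h x hx
    have hcard : Nat.card (N.map (MulAut.conj s).toMonoidHom) = Nat.card N :=
      Subgroup.card_map_of_injective (MulAut.conj s).injective
    rw [Subgroup.mem_normalizer_iff_map_conj_eq]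
    exact Subgroup.eq_of_le_of_card_ge hmap hcard.ge
  have hle : Subgroup.zpowers s ≤ Subgroup.normalizer (N : Set Q) :=
    (Subgroup.zpowers_le).2 hn
  have hset := Subgroup.coe_mul_of_right_le_normalizer_left N (Subgroup.zpowers s) hle
  calc Nat.card ↥(N ⊔ Subgroup.zpowers s)
      = Nat.card ((N : Set Q) * (Subgroup.zpowers s : Set Q) : Set Q) := by rw [← hset]; rfl
    _ ≤ Nat.card N * Nat.card (Subgroup.zpowers s) := Set.natCard_mul_le
    _ ≤ Nat.card N * k := by
        rw [Nat.card_zpowers]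
        exact Nat.mul_le_mul_left _ (orderOf_le_of_pow_eq_one hk hs)

/-- The basic estimate behind every loss term: adjoining a normalizing element costs at most its
order on level `m`, a divisor of 2^m. -/
theorem stab_relIndex_sup_zpowers_le (m : ℕ) (N : Subgroup AutT) {s : AutT}
    (h : ∀ x ∈ N, s * x * s⁻¹ ∈ N) :
    (stab m).relIndex (N ⊔ Subgroup.zpowers s) ≤ (stab m).relIndex N * 2 ^ m := by
  have hker : stab m = (QuotientGroup.mk' (stab m)).ker := (QuotientGroup.ker_mk' _).symm
  have hcard : ∀ G : Subgroup AutT, (stab m).relIndex G =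
      Nat.card (G.map (QuotientGroup.mk' (stab m))) := fun G => by
    rw [← Subgroup.relIndex_ker, ← hker]
  have : Finite (N.map (QuotientGroup.mk' (stab m))) :=
    Nat.finite_of_card_ne_zero (by rw [← hcard]; exact stab_relIndex_ne_zero m N)
  rw [hcard, hcard, Subgroup.map_sup, MonoidHom.map_zpowers]
  refine card_sup_zpowers_le _ (by positivity) ?_ ?_
  · rw [← map_pow]
    exact (QuotientGroup.eq_one_iff _).2 (pow_mem_stab s m)
  · rintro _ ⟨x, hx, rfl⟩
    exact ⟨_, h x hx, by simp⟩

/-! Copies of a group at a vertex. -/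

theorem conj_mem_of_sec {G : Subgroup AutT} {g x y : AutT} {u v : List Bool} (hg : g ∈ G)
    (hs : Sec g u v y) (hx : star u x ∈ G) : star v (y * x * y⁻¹) ∈ G := by
  rw [← conj_star hs]
  exact mul_mem (mul_mem hg hx) (inv_mem hg)

/-- Both directions are assumed on the generators because `L` may be infinite, where s L s⁻¹ ⊆ L
need not be an equality. -/
theorem closure_conj_mem {Q : Type*} [Group Q] {S : Set Q} {L : Subgroup Q}
    (h : ∀ s ∈ S, ∀ x ∈ L, s * x * s⁻¹ ∈ L) (h' : ∀ s ∈ S, ∀ x ∈ L, s⁻¹ * x * s ∈ L) :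
    ∀ s ∈ Subgroup.closure S, ∀ x ∈ L, s * x * s⁻¹ ∈ L := by
  have hle : Subgroup.closure S ≤ Subgroup.normalizer (L : Set Q) := by
    refine (Subgroup.closure_le _).2 fun s hs => ?_
    refine Subgroup.mem_normalizer_iff.2 fun x => ⟨h s hs x, fun hx => ?_⟩
    have := h' s hs _ hx
    simpa [mul_assoc] using this
  intro s hs x hx
  exact (Subgroup.mem_normalizer_iff.1 (hle hs) x).1 hx

/-- If the sections at `u` of elements of `G` that fix `u` include a generating set of `K`, then `K`
normalizes the group of those `x` whose copy at `u` lies in `G`. -/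
theorem star_conj_mem {G : Subgroup AutT} {S : Set AutT} {u : List Bool}
    (h : ∀ s ∈ S, ∃ g ∈ G, Sec g u u s) :
    ∀ s ∈ Subgroup.closure S, ∀ x, star u x ∈ G → star u (s * x * s⁻¹) ∈ G := by
  refine closure_conj_mem (L := G.comap (starHom u)) ?_ ?_
  · intro s hs x hx
    obtain ⟨g, hg, hsec⟩ := h s hs
    exact conj_mem_of_sec hg hsec hx
  · intro s hs x hx
    obtain ⟨g, hg, hsec⟩ := h s hs
    have := conj_mem_of_sec (inv_mem hg) hsec.inv hx
    rw [inv_inv] at this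
    exact this

/-- A group generated by a list of `k` elements that commute modulo a normal subgroup `L` is not
much larger than `L`. -/
theorem stab_relIndex_closure_le (m : ℕ) (L : Subgroup AutT) (l : List AutT)
    (hL : ∀ s ∈ l, ∀ x ∈ L, s * x * s⁻¹ ∈ L)
    (hc : ∀ s ∈ l, ∀ t ∈ l, s * t * s⁻¹ * t⁻¹ ∈ L) :
    (stab m).relIndex (L ⊔ Subgroup.closure {x | x ∈ l}) ≤
      (stab m).relIndex L * 2 ^ (m * l.length) := by
  induction l with
  | nil => simp
  | cons s l ih =>
    have ih := ih (fun s hs => hL s (List.mem_cons_of_mem _ hs))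
      (fun s hs t ht => hc s (List.mem_cons_of_mem _ hs) t (List.mem_cons_of_mem _ ht))
    have hset : {x | x ∈ s :: l} = {x | x ∈ l} ∪ {s} := by
      ext x; simp
    rw [hset, Subgroup.closure_union, ← Subgroup.zpowers_eq_closure, ← sup_assoc]
    refine (stab_relIndex_sup_zpowers_le m _ ?_).trans ?_
    -- The new generator normalizes the group built so far: it normalizes `L`, and s t s⁻¹ = [s, t]
    -- t with [s, t] in `L`.
    · suffices H : (L ⊔ Subgroup.closure {x | x ∈ l} : Subgroup AutT) ≤
          (L ⊔ Subgroup.closure {x | x ∈ l}).comap (MulAut.conj s).toMonoidHom from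
        fun _ hx => H hx
      refine sup_le (fun x hx => ?_) ((Subgroup.closure_le _).2 fun t ht => ?_)
      · change s * x * s⁻¹ ∈ L ⊔ Subgroup.closure {x | x ∈ l}
        exact Subgroup.mem_sup_left (hL s (by simp) x hx)
      · have h1 := hc s (by simp) t (List.mem_cons_of_mem _ ht)
        have h2 : s * t * s⁻¹ = (s * t * s⁻¹ * t⁻¹) * t := by group
        change s * t * s⁻¹ ∈ L ⊔ Subgroup.closure {x | x ∈ l}
        rw [h2]
        exact mul_mem (Subgroup.mem_sup_left h1)
          (Subgroup.mem_sup_right (Subgroup.subset_closure ht))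
    · rw [List.length_cons, mul_add, mul_one, pow_add, ← mul_assoc]
      exact Nat.mul_le_mul_right _ ih

/-! The adding machine as addition of one. -/

/-- The number with binary digits `w`, the least significant digit first. -/
def val : List Bool → ℕ
  | [] => 0
  | x :: w => x.toNat + 2 * val w

theorem val_lt (w : List Bool) : val w < 2 ^ w.length := by
  induction w with
  | nil => simp [val]
  | cons x w ih =>
    have := Bool.toNat_le x
    rw [val, List.length_cons, pow_succ]
    omega

theorem val_inj {u v : List Bool} (hl : u.length = v.length) (h : val u = val v) : u = v := by
  induction u generalizing v with
  | nil => exact (List.length_eq_zero_iff.1 hl.symm).symm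
  | cons x u ih =>
    rcases v with _ | ⟨y, v⟩
    · simp at hl
    rw [val, val] at h
    have hx := Bool.toNat_le x
    have hy := Bool.toNat_le y
    have hxy : x.toNat = y.toNat := by omega
    have hxy' : x = y := by cases x <;> cases y <;> simp_all
    rw [hxy', ih (by simpa using hl) (by omega)]

theorem a_sec {n : ℕ} {u : List Bool} (hu : u.length = n) : Sec (a n) u (a n u) 1 := by
  induction n generalizing u with
  | zero =>
    obtain rfl := List.length_eq_zero_iff.1 hu
    exact fun _ => rfl
  | succ n ih =>
    rcases u with _ | ⟨_ | _, u⟩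
    · simp at hu
    · exact (Sec.one u).pair_false true
    · exact (ih (by simpa using hu)).pair_true true

theorem val_a {n : ℕ} {u : List Bool} (hu : u.length = n) :
    val (a n u) ≡ val u + 1 [MOD 2 ^ n] := by
  induction n generalizing u with
  | zero => exact Nat.modEq_one
  | succ n ih =>
    rcases u with _ | ⟨_ | _, u⟩
    · simp at hu
    · have : a (n + 1) (false :: u) = true :: u := rfl
      rw [this]
      simp [val, add_comm, Nat.ModEq.refl]
    · have : a (n + 1) (true :: u) = false :: a n u := rfl
      rw [this]
      have h := (ih (u := u) (by simpa using hu)).mul_left' 2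
      rw [← pow_succ'] at h
      have he : val (true :: u) + 1 = 2 * (val u + 1) := by
        rw [val, Bool.toNat_true]
        ring
      rw [he, val, Bool.toNat_false, zero_add]
      exact h

theorem a_pow_sec {n : ℕ} (k : ℕ) {u : List Bool} (hu : u.length = n) :
    Sec (a n ^ k) u ((a n ^ k) u) 1 := by
  induction k with
  | zero => exact Sec.one u
  | succ k ih =>
    rw [pow_succ']
    have := (a_sec (n := n) (u := (a n ^ k) u) (by rw [length_apply, hu])).mul ih
    rwa [mul_one] at this

theorem val_a_pow {n : ℕ} (k : ℕ) {u : List Bool} (hu : u.length = n) :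
    val ((a n ^ k) u) ≡ val u + k [MOD 2 ^ n] := by
  induction k with
  | zero => exact Nat.ModEq.refl _
  | succ k ih =>
    rw [pow_succ', mul_apply, ← add_assoc]
    exact (val_a (by rw [length_apply, hu])).trans (ih.add_right 1)

/-- `a n` adds one modulo 2^n to the number of a vertex, so its powers act transitively on level
`n`, and their sections there are trivial. -/
theorem exists_a_pow {n : ℕ} {u v : List Bool} (hu : u.length = n) (hv : v.length = n) :
    ∃ k, Sec (a n ^ k) u v 1 := by
  have hlt := val_lt u
  rw [hu] at hlt
  have h := val_a_pow (val v + 2 ^ n - val u) hu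
  have he : val u + (val v + 2 ^ n - val u) = val v + 2 ^ n := by omega
  rw [he] at h
  have h' : val ((a n ^ (val v + 2 ^ n - val u)) u) ≡ val v [MOD 2 ^ n] :=
    h.trans (Nat.add_modEq_right ..)
  have h1 := val_lt ((a n ^ (val v + 2 ^ n - val u)) u)
  have h2 := val_lt v
  rw [length_apply, hu] at h1
  rw [hv] at h2
  have h3 := val_inj (by rw [length_apply, hu, hv]) (h'.eq_of_lt_of_lt h1 h2)
  refine ⟨val v + 2 ^ n - val u, ?_⟩
  have := a_pow_sec (val v + 2 ^ n - val u) hu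
  rwa [h3] at this

/-! The spinal word construction. -/

/-- The word `1^i 0^(n - i)`. -/
def spine (n i : ℕ) : List Bool := List.replicate i true ++ List.replicate (n - i) false

theorem length_spine {n i : ℕ} (h : i ≤ n) : (spine n i).length = n := by
  simp [spine, h]

theorem val_spine (n i : ℕ) : val (spine n i) + 1 = 2 ^ i := by
  have h0 : ∀ k, val (List.replicate k false) = 0 := by
    intro k
    induction k with
    | zero => rfl
    | succ k ih => simp [List.replicate_succ, val, ih]
  rw [spine]
  generalize n - i = k
  induction i with
  | zero => simp [h0]
  | succ i ih =>
    rw [List.replicate_succ, List.cons_append, val, pow_succ, ← ih]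
    simp
    ring

/-- Recursive form of `delta`: the spine vertices other than 0^n all lie below the letter 1. -/
theorem delta_cons (g : AutT) (gs : List AutT) :
    delta (g :: gs) = pair (star (List.replicate gs.length false) g) (delta gs) false := by
  have hs : ∀ l : List AutT, (l.map fun x => pair 1 x false).prod = pair 1 l.prod false := by
    intro l
    induction l with
    | nil => simp [pair_one]
    | cons x l ih => simp [ih, pair_mul]
  rw [delta, List.mapIdx_cons, List.prod_cons]
  have hmap : (gs.mapIdx fun i g' => star (List.replicate (i + 1) true ++
      List.replicate ((g :: gs).length - (i + 1)) false) g') =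
      (gs.mapIdx fun i g' => star (List.replicate i true ++
        List.replicate (gs.length - i) false) g').map fun x => pair 1 x false := by
    refine List.ext_getElem (by simp) fun i h₁ h₂ => ?_
    simp [List.replicate_succ, star]
  rw [hmap, hs]
  simp [List.replicate_succ, star, pair_mul, delta]

/-- The section of `delta gs` at the vertex `u`. -/
def deltaSec : List AutT → List Bool → AutT
  | g :: gs, false :: u => if u = List.replicate gs.length false then g else 1
  | _ :: gs, true :: u => deltaSec gs u
  | _, _ => 1

theorem delta_sec {gs : List AutT} {u : List Bool} (hu : u.length = gs.length) :
    Sec (delta gs) u u (deltaSec gs u) := by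
  induction gs generalizing u with
  | nil =>
    obtain rfl := List.length_eq_zero_iff.1 hu
    exact fun _ => rfl
  | cons g gs ih =>
    rw [delta_cons]
    rcases u with _ | ⟨_ | _, u⟩
    · simp at hu
    · rw [deltaSec]
      have hu' : u.length = gs.length := by simpa using hu
      split_ifs with h
      · subst h
        exact (star_append _ g).pair_false false
      · exact (star_of_ne g (by simp [hu']) h).pair_false false
    · exact (ih (by simpa using hu)).pair_true false

theorem deltaSec_spine {gs : List AutT} {i : ℕ} (hi : i < gs.length) :
    deltaSec gs (spine gs.length i) = gs[i] := by
  induction gs generalizing i with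
  | nil => simp at hi
  | cons g gs ih =>
    rcases i with _ | i
    · simp [spine, List.replicate_succ, deltaSec]
    · have h := ih (i := i) (by simpa using hi)
      rw [List.getElem_cons_succ, ← h]
      simp [spine, List.replicate_succ, deltaSec]

theorem exists_spine_of_deltaSec_ne {gs : List AutT} {u : List Bool} (hu : u.length = gs.length)
    (h : deltaSec gs u ≠ 1) : ∃ i < gs.length, u = spine gs.length i := by
  induction gs generalizing u with
  | nil => exact absurd rfl h
  | cons g gs ih =>
    rcases u with _ | ⟨_ | _, u⟩
    · simp at hu
    · rw [deltaSec] at h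
      refine ⟨0, by simp, ?_⟩
      split_ifs at h with hu'
      · simp [hu', spine, List.replicate_succ]
      · exact absurd rfl h
    · obtain ⟨i, hi, rfl⟩ := ih (by simpa using hu) h
      exact ⟨i + 1, by simpa using hi, by simp [spine, List.replicate_succ]⟩

/-- A sum of two powers of two determines the unordered pair of exponents. -/
theorem two_pow_add_two_pow_inj {i j k l : ℕ} (hij : i ≠ j) (h : 2 ^ j + 2 ^ k = 2 ^ i + 2 ^ l) :
    j = l := by
  by_contra hjl
  have hmono : ∀ {x y : ℕ}, x < y → 2 * 2 ^ x ≤ 2 ^ y := fun hxy => by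
    rw [← pow_succ']
    exact Nat.pow_le_pow_right (by norm_num) hxy
  have hp : ∀ x : ℕ, 0 < 2 ^ x := fun x => by positivity
  have hpi := hp i
  have hpj := hp j
  have hpk := hp k
  have hpl := hp l
  have hinj : ∀ {x y : ℕ}, 2 ^ x = 2 ^ y → x = y := fun h => Nat.pow_right_injective le_rfl h
  rcases lt_trichotomy j i with h1 | h1 | h1
  · have := hmono h1
    rcases lt_trichotomy k i with h2 | h2 | h2
    · have := hmono h2
      omega
    · subst h2
      exact hjl (hinj (by omega))
    · have := hmono h2
      rcases lt_trichotomy k l with h3 | h3 | h3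
      · have := hmono h3
        omega
      · subst h3
        exact hij (hinj (by omega))
      · have := hmono h3
        omega
  · exact hij h1.symm
  · have := hmono h1
    rcases lt_trichotomy j l with h2 | h2 | h2
    · have := hmono h2
      rcases lt_trichotomy k l with h3 | h3 | h3
      · have := hmono h3
        omega
      · subst h3
        exact hij (hinj (by omega))
      · have := hmono h3
        omega
    · exact hjl h2
    · have := hmono h2
      omega

/-- The numbers `2 ^ i - 1` with `i < n` have distinct differences modulo `2 ^ n`. -/
theorem spine_shift {n i j k l s : ℕ} (hi : i < n) (hj : j < n) (hk : k < n) (hl : l < n)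
    (hij : i ≠ j) (h : val (spine n j) ≡ val (spine n i) + s [MOD 2 ^ n])
    (h' : val (spine n l) ≡ val (spine n k) + s [MOD 2 ^ n]) : j = l := by
  have hmod : 2 ^ j + 2 ^ k ≡ 2 ^ i + 2 ^ l [MOD 2 ^ n] := by
    have h1 := (h.add_right 1).add ((h'.add_right 1).symm)
    have h2 : val (spine n i) + s + 1 + (val (spine n l) + 1) = 2 ^ i + 2 ^ l + s := by
      rw [← val_spine n i, ← val_spine n l]; ring
    have h3 : val (spine n j) + 1 + (val (spine n k) + s + 1) = 2 ^ j + 2 ^ k + s := by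
      rw [← val_spine n j, ← val_spine n k]; ring
    rw [h2, h3] at h1
    exact Nat.ModEq.add_right_cancel' s h1
  have hb : ∀ {x}, x < n → 2 * 2 ^ x ≤ 2 ^ n := fun hx => by
    rw [← pow_succ']
    exact Nat.pow_le_pow_right (by norm_num) hx
  have hp : ∀ x : ℕ, 0 < 2 ^ x := fun x => by positivity
  have hbi := hb hi
  have hbj := hb hj
  have hbk := hb hk
  have hbl := hb hl
  have hpi := hp i
  have hpj := hp j
  have hpk := hp k
  have hpl := hp l
  refine two_pow_add_two_pow_inj (k := k) hij ?_
  -- Both sums lie between 2 and 2^n, so after subtracting 1 they are residues below 2^n and the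
  -- congruence becomes an equality.
  have h1 : 2 ^ j + 2 ^ k - 1 ≡ 2 ^ i + 2 ^ l - 1 [MOD 2 ^ n] := by
    refine Nat.ModEq.add_right_cancel' 1 ?_
    rwa [Nat.sub_add_cancel (by omega), Nat.sub_add_cancel (by omega)]
  have := h1.eq_of_lt_of_lt (by omega) (by omega)
  omega

/-- The commutator of `delta gs` with a suitable conjugate is concentrated at one vertex. -/
theorem delta_commutator {gs : List AutT} {i j s : ℕ} (hi : i < gs.length) (hj : j < gs.length)
    (hij : i ≠ j) (hs : Sec (a gs.length ^ s) (spine gs.length i) (spine gs.length j) 1) :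
    delta gs * (a gs.length ^ s * delta gs * (a gs.length ^ s)⁻¹) * (delta gs)⁻¹ *
      (a gs.length ^ s * delta gs * (a gs.length ^ s)⁻¹)⁻¹ =
      star (spine gs.length j) (gs[j] * gs[i] * gs[j]⁻¹ * gs[i]⁻¹) := by
  have hli := length_spine hi.le
  have hlj := length_spine hj.le
  refine ext_of_sec gs.length fun u hu => ⟨u,
    deltaSec gs u * deltaSec gs ((a gs.length ^ s)⁻¹ u) * (deltaSec gs u)⁻¹ *
      (deltaSec gs ((a gs.length ^ s)⁻¹ u))⁻¹, ?_, ?_⟩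
  · set v := (a gs.length ^ s)⁻¹ u with hv
    have hlv : v.length = gs.length := by rw [hv, length_apply, hu]
    have h1 : Sec (a gs.length ^ s) v u 1 := by
      have := a_pow_sec s hlv
      rwa [hv, apply_inv_self, ← hv] at this
    have h2 := (h1.mul (delta_sec hlv)).mul h1.inv
    rw [one_mul, inv_one, mul_one] at h2
    have h3 := delta_sec hu
    exact ((h3.mul h2).mul h3.inv).mul h2.inv
  · by_cases huj : u = spine gs.length j
    · subst huj
      have hv : (a gs.length ^ s)⁻¹ (spine gs.length j) = spine gs.length i := by
        rw [← hs.apply, inv_apply_self]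
      rw [hv, deltaSec_spine hi, deltaSec_spine hj]
      exact star_append _ _
    -- If both sections were nontrivial, `u` and its translate back would both lie on the spine, and
    -- distinctness of differences would force `u` to be spine vertex `j`.
    · have hcomm : deltaSec gs u = 1 ∨ deltaSec gs ((a gs.length ^ s)⁻¹ u) = 1 := by
        by_contra hne
        rw [not_or] at hne
        obtain ⟨l, hl, rfl⟩ := exists_spine_of_deltaSec_ne hu hne.1
        obtain ⟨k, hk, hk'⟩ := exists_spine_of_deltaSec_ne (by rw [length_apply, hu]) hne.2
        have h1 := val_a_pow s hli
        rw [hs.apply] at h1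
        have h2 := val_a_pow s (length_spine hk.le)
        rw [← hk', apply_inv_self, hk'] at h2
        exact huj (by rw [spine_shift hi hj hk hl hij h1 h2])
      have h1 := star_of_ne (u := spine gs.length j) (v := u)
        (gs[j] * gs[i] * gs[j]⁻¹ * gs[i]⁻¹) (by rw [hlj, hu]) huj
      rcases hcomm with h | h
      all_goals
        rw [h]
        simpa only [mul_one, one_mul, inv_one, mul_inv_cancel] using h1

/-- The group generated by `a n` and `delta gs`, with `gs` of length `n`, contains at each vertex
of level `n` a large part of the group generated by `gs`. -/
theorem stab_relIndex_closure_delta (m : ℕ) (gs : List AutT) :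
    (stab m).relIndex (Subgroup.closure {x | x ∈ gs}) ^ 2 ^ gs.length ≤
      (stab (m + gs.length)).relIndex (Subgroup.closure {a gs.length, delta gs}) *
        (2 ^ (m * gs.length)) ^ 2 ^ gs.length := by
  set G := Subgroup.closure {a gs.length, delta gs} with hG
  set K := Subgroup.closure {x | x ∈ gs} with hK
  have haG : a gs.length ∈ G := Subgroup.subset_closure (by simp)
  have hdG : delta gs ∈ G := Subgroup.subset_closure (by simp)
  set u₀ := List.replicate gs.length false with hu₀
  have hlu₀ : u₀.length = gs.length := by simp [hu₀]
  have move : ∀ u v : List Bool, u.length = gs.length → v.length = gs.length →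
      ∀ x, star u x ∈ G → star v x ∈ G := by
    intro u v hu hv x hx
    obtain ⟨k, hk⟩ := exists_a_pow hu hv
    simpa using conj_mem_of_sec (pow_mem haG k) hk hx
  have hnorm : ∀ s ∈ K, ∀ x, star u₀ x ∈ G → star u₀ (s * x * s⁻¹) ∈ G := by
    refine star_conj_mem fun s hs => ?_
    obtain ⟨i, hi, rfl⟩ := List.mem_iff_getElem.1 hs
    obtain ⟨k, hk⟩ := exists_a_pow (length_spine hi.le) hlu₀
    have h1 := (hk.mul (delta_sec (length_spine hi.le))).mul hk.inv
    rw [deltaSec_spine hi, one_mul, inv_one, mul_one] at h1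
    exact ⟨_, mul_mem (mul_mem (pow_mem haG k) hdG) (inv_mem (pow_mem haG k)), h1⟩
  -- `L` is normalized by `K` and contains the commutators of the generators, so passing from `L` to
  -- `K` costs at most a factor 2^m per generator.
  set L := K ⊓ G.comap (starHom u₀) with hL
  have hKL : K ≤ L ⊔ Subgroup.closure {x | x ∈ gs} := le_sup_right
  have hgK : ∀ s ∈ gs, s ∈ K := fun s hs => Subgroup.subset_closure hs
  have h1 := stab_relIndex_closure_le m L gs
    (fun s hs x hx => ⟨K.mul_mem (K.mul_mem (hgK s hs) hx.1) (K.inv_mem (hgK s hs)),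
      hnorm s (hgK s hs) x hx.2⟩)
    (fun s hs t ht => by
      refine ⟨K.mul_mem (K.mul_mem (K.mul_mem (hgK s hs) (hgK t ht)) (K.inv_mem (hgK s hs)))
        (K.inv_mem (hgK t ht)), ?_⟩
      obtain ⟨j, hj, rfl⟩ := List.mem_iff_getElem.1 hs
      obtain ⟨i, hi, rfl⟩ := List.mem_iff_getElem.1 ht
      by_cases hij : i = j
      · subst hij
        rw [mul_inv_cancel_right, mul_inv_cancel]
        exact one_mem _
      obtain ⟨k, hk⟩ := exists_a_pow (length_spine hi.le) (length_spine hj.le)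
      refine move _ u₀ (length_spine hj.le) hlu₀ _ ?_
      rw [← delta_commutator hi hj hij hk]
      have hc : a gs.length ^ k * delta gs * (a gs.length ^ k)⁻¹ ∈ G :=
        mul_mem (mul_mem (pow_mem haG k) hdG) (inv_mem (pow_mem haG k))
      exact mul_mem (mul_mem (mul_mem hdG hc) (inv_mem hdG)) (inv_mem hc))
  have h2 : (stab m).relIndex L ^ 2 ^ gs.length ≤ (stab (m + gs.length)).relIndex G :=
    stab_relIndex_pow_le fun u hu x hx => move u₀ u hlu₀ hu x hx.2
  calc (stab m).relIndex K ^ 2 ^ gs.length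
      ≤ ((stab m).relIndex L * 2 ^ (m * gs.length)) ^ 2 ^ gs.length :=
        Nat.pow_le_pow_left ((stab_relIndex_mono m hKL).trans h1) _
    _ = (stab m).relIndex L ^ 2 ^ gs.length * (2 ^ (m * gs.length)) ^ 2 ^ gs.length := mul_pow ..
    _ ≤ _ := Nat.mul_le_mul_right _ h2

/-! The spinal groups generated by `a` and the `b i N`. -/

/-- The group generated by `a` and `b_{(1, N)}, …, b_{(N, N)}`. -/
def spinal (N : ℕ) : Subgroup AutT :=
  Subgroup.closure ({a 1} ∪ {x | ∃ i, 1 ≤ i ∧ i ≤ N ∧ x = b i N})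

theorem a_mem_spinal (N : ℕ) : a 1 ∈ spinal N := Subgroup.subset_closure (Or.inl rfl)

theorem b_mem_spinal {i N : ℕ} (h₁ : 1 ≤ i) (h₂ : i ≤ N) : b i N ∈ spinal N :=
  Subgroup.subset_closure (Or.inr ⟨i, h₁, h₂, rfl⟩)

theorem star_mem_stab {m : ℕ} {g : AutT} (hg : g ∈ stab m) (u : List Bool) :
    star u g ∈ stab (m + u.length) := by
  intro w hw
  obtain ⟨v, z, hv, rfl⟩ := exists_append (n := u.length) (w := w) (by omega)
  by_cases h : v = u
  · subst h
    have hz : z.length = m := by simp at hw; omega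
    rw [star_append, hg z hz]
  · rw [star_of_ne g hv.symm h]
    rfl

theorem pair_mem_stab_one (g₀ g₁ : AutT) : pair g₀ g₁ false ∈ stab 1 := by
  rw [← map_pairHom_top]
  exact ⟨(g₀, g₁), trivial, rfl⟩

theorem b_mem_stab_one {i N : ℕ} (h : i ≤ N) : b i N ∈ stab 1 := by
  rcases h.lt_or_eq with h | rfl
  · rw [b_rec h]
    exact pair_mem_stab_one _ _
  · rw [b_rec_last]
    exact pair_mem_stab_one _ _

/-- On the first `k + 2` levels, `b_{(N - k, N)}` only exchanges the two subtrees at a vertex of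
level `k + 1`. -/
theorem b_mod_stab {i k N : ℕ} (hi : 1 ≤ i) (h : i + k = N) :
    ∃ w : List Bool, w.length = k + 1 ∧ (star w (a 1))⁻¹ * b i N ∈ stab (k + 2) := by
  induction k generalizing i with
  | zero =>
    obtain rfl : i = N := h
    refine ⟨[false], rfl, ?_⟩
    have : (star [false] (a 1))⁻¹ * b i i = star [true] (b 1 i) := by
      rw [b_rec_last, inv_mul_eq_iff_eq_mul]
      change _ = pair (a 1) 1 false * pair 1 (b 1 i) false
      rw [pair_mul, mul_one, one_mul]
    rw [this]
    exact star_mem_stab (b_mem_stab_one hi) [true]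
  | succ k ih =>
    obtain ⟨w, hw, hm⟩ := ih (i := i + 1) (by omega) (by omega)
    refine ⟨true :: w, by simp [hw], ?_⟩
    have : (star (true :: w) (a 1))⁻¹ * b i N = star [true] ((star w (a 1))⁻¹ * b (i + 1) N) := by
      rw [b_rec (by omega), star_mul, inv_mul_eq_iff_eq_mul, ← mul_assoc]
      change _ = pair 1 (star w (a 1)) false * pair 1 (star w (a 1))⁻¹ false *
        pair 1 (b (i + 1) N) false
      rw [pair_mul, pair_mul, mul_inv_cancel, one_mul, one_mul, one_mul]
    rw [this]
    exact star_mem_stab hm [true]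

/-- `G` is transitive on level `j`. -/
def TransOn (G : Subgroup AutT) (j : ℕ) : Prop :=
  ∀ u v : List Bool, u.length = j → v.length = j → ∃ g ∈ G, g u = v

theorem TransOn.star_a_mem {G : Subgroup AutT} {j : ℕ} (hG : TransOn G j) {w₀ : List Bool}
    (hw₀ : w₀.length = j) (h₀ : star w₀ (a 1) ∈ G ⊔ stab (j + 1)) {w : List Bool}
    (hw : w.length = j) : star w (a 1) ∈ G ⊔ stab (j + 1) := by
  obtain ⟨g, hg, rfl⟩ := hG w₀ w hw₀ hw
  obtain ⟨y, hy⟩ := exists_sec w₀ g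
  have h1 := conj_mem_of_sec (Subgroup.mem_sup_left hg) hy h₀
  -- The unknown section `y` is harmless: modulo the index-two subgroup `stab 1`, a conjugate of the
  -- swap is the swap.
  have h2 : (y * a 1 * y⁻¹)⁻¹ * a 1 ∈ stab 1 := by
    have hmul : ∀ g h : AutT, g * h ∈ stab 1 ↔ (g ∈ stab 1 ↔ h ∈ stab 1) :=
      fun g h => Subgroup.mul_mem_iff_of_index_two stab_one_index
    have hinv : ∀ g : AutT, g⁻¹ ∈ stab 1 ↔ g ∈ stab 1 := fun g => Subgroup.inv_mem_iff _
    rw [hmul, hinv, hmul, hmul, hinv]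
    tauto
  have h3 := star_mem_stab h2 (g w₀)
  rw [hw, add_comm] at h3
  have h4 : star (g w₀) (a 1) =
      star (g w₀) (y * a 1 * y⁻¹) * star (g w₀) ((y * a 1 * y⁻¹)⁻¹ * a 1) := by
    rw [← star_mul, mul_inv_cancel_left]
  rw [h4]
  exact mul_mem h1 (Subgroup.mem_sup_right h3)

theorem TransOn.succ {G : Subgroup AutT} {j : ℕ} (hG : TransOn G j)
    (h : ∀ w : List Bool, w.length = j → star w (a 1) ∈ G ⊔ stab (j + 1)) :
    TransOn G (j + 1) := by
  -- Enlarging `G` by the stabilizer of the level does not change its action on that level.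
  suffices H : TransOn (G ⊔ stab (j + 1)) (j + 1) by
    intro u v hu hv
    obtain ⟨k, hk, hkuv⟩ := H u v hu hv
    obtain ⟨g, hg, s, hs, hgs⟩ := Subgroup.mem_sup_of_normal_right.1 hk
    refine ⟨g, hg, ?_⟩
    have hsu : s u = u := hs u hu
    rw [← hkuv, ← hgs, mul_apply, hsu]
  intro u v hu hv
  obtain ⟨u, u', hu', rfl⟩ := exists_append (n := j) (w := u) (by omega)
  obtain ⟨v, v', hv', rfl⟩ := exists_append (n := j) (w := v) (by omega)
  obtain ⟨x, rfl⟩ := List.length_eq_one_iff.1 (show u'.length = 1 by simp at hu; omega)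
  obtain ⟨y, rfl⟩ := List.length_eq_one_iff.1 (show v'.length = 1 by simp at hv; omega)
  obtain ⟨g, hg, rfl⟩ := hG u v hu' hv'
  obtain ⟨t, ht⟩ := exists_sec u g
  obtain ⟨z, hz⟩ := List.length_eq_one_iff.1 (length_apply t [x])
  by_cases hzy : z = y
  · exact ⟨g, Subgroup.mem_sup_left hg, by rw [ht, hz, hzy]⟩
  · refine ⟨star (g u) (a 1) * g, mul_mem (h _ hv') (Subgroup.mem_sup_left hg), ?_⟩
    rw [mul_apply, ht, hz, star_append]
    congr 1
    cases z <;> cases y <;> first | rfl | simp at hzy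

theorem two_le_relIndex_zpowers_a : 2 ≤ (stab 1).relIndex (Subgroup.zpowers (a 1)) := by
  have h0 := stab_relIndex_ne_zero 1 (Subgroup.zpowers (a 1))
  have h1 : (stab 1).relIndex (Subgroup.zpowers (a 1)) ≠ 1 := fun h => by
    have := Subgroup.relIndex_eq_one.1 h (Subgroup.mem_zpowers (a 1)) [false] rfl
    exact absurd this (by change [true] ≠ [false]; simp)
  omega

/-- The independent swaps below the 2^j vertices of level `j` contribute 2^(2^j) elements that fix
level `j`. -/
theorem stab_relIndex_succ_ge {G : Subgroup AutT} {j : ℕ}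
    (h : ∀ w : List Bool, w.length = j → star w (a 1) ∈ G ⊔ stab (j + 1)) :
    2 ^ 2 ^ j * (stab j).relIndex G ≤ (stab (j + 1)).relIndex G := by
  rw [← Subgroup.relIndex_sup_right (H := G) (K := stab (j + 1)),
    ← inf_eq_left.2 (stab_anti (Nat.le_succ j)), ← Subgroup.relIndex_inf_mul_relIndex,
    inf_eq_left.2 (stab_anti (Nat.le_succ j))]
  refine Nat.mul_le_mul ?_ (stab_relIndex_mono j le_sup_left)
  rw [Nat.succ_eq_add_one, add_comm]
  refine le_trans (Nat.pow_le_pow_left two_le_relIndex_zpowers_a _)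
    (stab_relIndex_pow_le fun w hw x hx => ?_)
  refine ⟨?_, ?_⟩
  · have := star_mem_stab (m := 0) (g := x) (by rw [stab_zero]; trivial) w
    rwa [hw, zero_add] at this
  · suffices H : Subgroup.zpowers (a 1) ≤ (G ⊔ stab (j + 1)).comap (starHom w) by
      rw [add_comm]
      exact H hx
    exact Subgroup.zpowers_le.2 (h w hw)

/-- Up to level N + 1 the spinal group is as large as Aut T: `a` swaps at the root, and `b_{(N-k,
N)}` supplies one swap at level k + 1 ≤ N, which transitivity spreads over that level. -/
theorem spinal_level (N j : ℕ) (hj : j ≤ N + 1) :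
    TransOn (spinal N) j ∧ 2 ^ (2 ^ j - 1) ≤ (stab j).relIndex (spinal N) := by
  induction j with
  | zero =>
    refine ⟨fun u v hu hv => ⟨1, one_mem _, ?_⟩, ?_⟩
    · rw [List.length_eq_zero_iff.1 hu, List.length_eq_zero_iff.1 hv, apply_nil]
    · exact Nat.pos_of_ne_zero (stab_relIndex_ne_zero 0 (spinal N))
  | succ j ih =>
    obtain ⟨ht, hc⟩ := ih (by omega)
    have h₀ : ∃ w : List Bool, w.length = j ∧ star w (a 1) ∈ spinal N ⊔ stab (j + 1) := by
      rcases j with _ | k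
      · exact ⟨[], rfl, Subgroup.mem_sup_left (a_mem_spinal N)⟩
      · obtain ⟨w, hw, hm⟩ := b_mod_stab (i := N - k) (k := k) (N := N) (by omega) (by omega)
        refine ⟨w, hw, ?_⟩
        have : star w (a 1) = b (N - k) N * ((star w (a 1))⁻¹ * b (N - k) N)⁻¹ := by group
        rw [this]
        exact mul_mem (Subgroup.mem_sup_left (b_mem_spinal (by omega) (by omega)))
          (Subgroup.mem_sup_right (inv_mem hm))
    obtain ⟨w₀, hw₀, h₀⟩ := h₀
    have h : ∀ w : List Bool, w.length = j → star w (a 1) ∈ spinal N ⊔ stab (j + 1) :=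
      fun w hw => ht.star_a_mem hw₀ h₀ hw
    refine ⟨ht.succ h, le_trans ?_ (stab_relIndex_succ_ge h)⟩
    refine le_trans (le_of_eq ?_) (Nat.mul_le_mul_left _ hc)
    rw [← pow_add]
    congr 1
    have := Nat.one_le_two_pow (n := j)
    rw [pow_succ]
    omega

theorem b_mul_self {i N : ℕ} (h₁ : 1 ≤ i) (h₂ : i ≤ N) : b i N * b i N = 1 := by
  -- The induction is on depth for all `i` at once, since `b N N` refers back to `b 1 N`.
  suffices H : ∀ d i, 1 ≤ i → i ≤ N → ∀ w : List Bool, w.length ≤ d → b i N (b i N w) = w from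
    ext_apply fun w => H _ i h₁ h₂ w le_rfl
  intro d
  induction d with
  | zero =>
    intro i _ _ w hw
    obtain rfl : w = [] := by simpa using hw
    rw [apply_nil, apply_nil]
  | succ d ih =>
    intro i h₁ h₂ w hw
    rcases w with _ | ⟨_ | _, w⟩
    · rw [apply_nil, apply_nil]
    all_goals rcases h₂.lt_or_eq with h | rfl
    · rw [b_rec h]
      rfl
    · rw [b_rec_last, pair_false, pair_false, ← mul_apply, a_one_mul_self]
      rfl
    · rw [b_rec h, pair_true, Bool.not_false, pair_true, Bool.not_false,
        ih (i + 1) (by omega) h w (by simpa using hw)]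
    · rw [b_rec_last, pair_true, Bool.not_false, pair_true, Bool.not_false,
        ih 1 le_rfl h₁ w (by simpa using hw)]

/-- The spinal group contains, up to a small index, a copy of its square. -/
theorem spinal_relIndex_succ {N : ℕ} (hN : 1 ≤ N) (m : ℕ) :
    (stab m).relIndex (spinal N) ^ 2 ≤
      (stab (m + 1)).relIndex (spinal N) * (2 ^ m * 2 ^ m) ^ 2 := by
  set G := spinal N with hG
  have haG : a 1 ∈ G := a_mem_spinal N
  have ha : (a 1)⁻¹ = a 1 := inv_eq_of_mul_eq_one_left a_one_mul_self
  have hb : (b 1 N)⁻¹ = b 1 N := inv_eq_of_mul_eq_one_left (b_mul_self le_rfl hN)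
  -- Every generator occurs as a section at the vertex 1: `a` from a conjugate of `b N N`, `b 1 N`
  -- from `b N N`, and `b i N` from `b (i - 1) N`.
  have hnorm : ∀ s ∈ G, ∀ x, star [true] x ∈ G → star [true] (s * x * s⁻¹) ∈ G := by
    refine star_conj_mem fun s hs => ?_
    rcases hs with rfl | ⟨i, hi, hiN, rfl⟩
    · refine ⟨a 1 * b N N * (a 1)⁻¹, mul_mem (mul_mem haG (b_mem_spinal hN le_rfl)) (inv_mem haG),
        fun w => ?_⟩
      rw [ha, b_rec_last]
      rfl
    · rcases hi.lt_or_eq with h | rfl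
      · refine ⟨b (i - 1) N, b_mem_spinal (by omega) (by omega), fun w => ?_⟩
        rw [b_rec (by omega), Nat.sub_add_cancel hi]
        rfl
      · refine ⟨b N N, b_mem_spinal hN le_rfl, fun w => ?_⟩
        rw [b_rec_last]
        rfl
  set L := G ⊓ G.comap (starHom [true]) with hL
  have hLn : ∀ s ∈ G, ∀ x ∈ L, s * x * s⁻¹ ∈ L := fun s hs x hx =>
    ⟨G.mul_mem (G.mul_mem hs hx.1) (G.inv_mem hs), hnorm s hs x hx.2⟩
  have hsq : (stab m).relIndex L ^ 2 ≤ (stab (m + 1)).relIndex G := by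
    rw [sq]
    refine stab_relIndex_mul_le (fun x hx => ?_) fun x hx => hx.2
    have hs : Sec (a 1) [true] [false] 1 := fun w => rfl
    simpa using conj_mem_of_sec haG hs hx.2
  set M := L ⊔ Subgroup.zpowers (a 1 * b 1 N) with hM
  have habG : a 1 * b 1 N ∈ G := mul_mem haG (b_mem_spinal le_rfl hN)
  -- For i ≥ 2, `b i N` lies in `L`, its copy at 1 being `b (i - 1) N`. So G/L is generated by the
  -- involutions `a 1` and `b 1 N`: it is dihedral, and `a 1` inverts the product of the two. Two
  -- cyclic extensions cost 2^m each.
  have hGM : G ≤ M ⊔ Subgroup.zpowers (a 1) := by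
    refine (Subgroup.closure_le _).2 ?_
    rintro _ (rfl | ⟨i, hi, hiN, rfl⟩)
    · exact Subgroup.mem_sup_right (Subgroup.mem_zpowers _)
    · rcases hi.lt_or_eq with h | rfl
      · refine Subgroup.mem_sup_left (Subgroup.mem_sup_left ⟨b_mem_spinal hi hiN, ?_⟩)
        have := b_rec (i := i - 1) (n := N) (by omega)
        rw [Nat.sub_add_cancel hi] at this
        change pair 1 (b i N) false ∈ G
        rw [← this]
        exact b_mem_spinal (by omega) (by omega)
      · have : b 1 N = (a 1)⁻¹ * (a 1 * b 1 N) := by group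
        rw [this]
        exact mul_mem (inv_mem (Subgroup.mem_sup_right (Subgroup.mem_zpowers _)))
          (Subgroup.mem_sup_left (Subgroup.mem_sup_right (Subgroup.mem_zpowers _)))
  have h1 : (stab m).relIndex M ≤ (stab m).relIndex L * 2 ^ m :=
    stab_relIndex_sup_zpowers_le m L (hLn _ habG)
  have h2 : (stab m).relIndex (M ⊔ Subgroup.zpowers (a 1)) ≤ (stab m).relIndex M * 2 ^ m := by
    refine stab_relIndex_sup_zpowers_le m M ?_
    suffices H : M ≤ M.comap (MulAut.conj (a 1)).toMonoidHom from fun _ hx => H hx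
    refine sup_le (fun x hx => ?_) (Subgroup.zpowers_le.2 ?_)
    · change a 1 * x * (a 1)⁻¹ ∈ M
      exact Subgroup.mem_sup_left (hLn _ haG x hx)
    · change a 1 * (a 1 * b 1 N) * (a 1)⁻¹ ∈ M
      have : a 1 * (a 1 * b 1 N) * (a 1)⁻¹ = (a 1 * b 1 N)⁻¹ := by
        rw [← mul_assoc, a_one_mul_self, one_mul, mul_inv_rev, hb]
      rw [this]
      exact inv_mem (Subgroup.mem_sup_right (Subgroup.mem_zpowers _))
  calc (stab m).relIndex G ^ 2
      ≤ ((stab m).relIndex L * (2 ^ m * 2 ^ m)) ^ 2 := by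
        refine Nat.pow_le_pow_left ((stab_relIndex_mono m hGM).trans (h2.trans ?_)) _
        rw [← mul_assoc]
        exact Nat.mul_le_mul_right _ h1
    _ = (stab m).relIndex L ^ 2 * (2 ^ m * 2 ^ m) ^ 2 := mul_pow ..
    _ ≤ _ := Nat.mul_le_mul_right _ hsq

/-! Densities. -/

/-- The binary logarithm of the order of `G` modulo level `m`, divided by `2 ^ m`. -/
noncomputable def density (G : Subgroup AutT) (m : ℕ) : ℝ :=
  Real.logb 2 ((stab m).relIndex G) / 2 ^ m

theorem stab_relIndex_pos (m : ℕ) (G : Subgroup AutT) : (0 : ℝ) < (stab m).relIndex G :=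
  Nat.cast_pos.2 (Nat.pos_of_ne_zero (stab_relIndex_ne_zero m G))

theorem density_mono {G K : Subgroup AutT} (h : G ≤ K) (m : ℕ) : density G m ≤ density K m := by
  refine div_le_div_of_nonneg_right ?_ (by positivity)
  exact Real.logb_le_logb_of_le (by norm_num) (stab_relIndex_pos m G)
    (Nat.cast_le.2 (stab_relIndex_mono m h))

/-- If `G` modulo level `m + n` contains `2 ^ n` copies of a large part of `K` modulo level `m`, its
density is not much smaller than that of `K`. -/
theorem density_add_ge {G K : Subgroup AutT} {m n d : ℕ}
    (h : (stab m).relIndex K ^ 2 ^ n ≤ (stab (m + n)).relIndex G * (2 ^ d) ^ 2 ^ n) :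
    density K m - d / 2 ^ m ≤ density G (m + n) := by
  have h1 : ((stab m).relIndex K : ℝ) ^ 2 ^ n ≤
      (stab (m + n)).relIndex G * ((2 : ℝ) ^ d) ^ 2 ^ n := by exact_mod_cast h
  have h2 := Real.logb_le_logb_of_le (b := 2) (by norm_num)
    (pow_pos (stab_relIndex_pos m K) _) h1
  rw [Real.logb_mul (stab_relIndex_pos _ G).ne' (by positivity), Real.logb_pow, Real.logb_pow,
    Real.logb_pow, Real.logb_self_eq_one (by norm_num)] at h2
  push_cast at h2
  rw [density, density, pow_add, ← sub_div, div_le_div_iff₀ (by positivity) (by positivity)]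
  have hm : (0 : ℝ) < 2 ^ m := by positivity
  nlinarith

theorem spinal_density {N : ℕ} (hN : 1 ≤ N) {m : ℕ} (hm : N + 1 ≤ m) :
    1 - (4 * N + 9) / 2 ^ (N + 1) ≤ density (spinal N) m := by
  -- The added term is the tail of the losses, ∑_{k ≥ m} 2k/2^k = (4m + 4)/2^m, so it absorbs each
  -- step exactly. At m = N + 1 the left side is 1 - 2^(-(N+1)), the density of Aut T.
  suffices H : 1 - (4 * N + 9) / 2 ^ (N + 1) + (4 * m + 4) / 2 ^ m ≤ density (spinal N) m by
    have : (0 : ℝ) ≤ (4 * m + 4) / 2 ^ m := by positivity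
    linarith
  induction m, hm using Nat.le_induction with
  | base =>
    have h := Real.logb_le_logb_of_le (b := 2) (x := (2 : ℝ) ^ (2 ^ (N + 1) - 1))
      (y := ((stab (N + 1)).relIndex (spinal N) : ℝ)) (by norm_num)
      (by positivity) (by exact_mod_cast (spinal_level N (N + 1) le_rfl).2)
    rw [Real.logb_pow, Real.logb_self_eq_one (by norm_num), mul_one,
      Nat.cast_sub Nat.one_le_two_pow] at h
    have h2 : (0 : ℝ) < 2 ^ (N + 1) := by positivity
    rw [density, le_div_iff₀ h2]
    refine le_trans (le_of_eq ?_) h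
    push_cast
    field_simp
    ring
  | succ m hm ih =>
    have h := density_add_ge (G := spinal N) (K := spinal N) (m := m) (n := 1) (d := m + m) (by
      rw [pow_one, pow_add]
      exact spinal_relIndex_succ hN m)
    refine le_trans ?_ ((sub_le_sub_right ih _).trans h)
    rw [pow_succ (2 : ℝ) m, add_sub_assoc]
    refine add_le_add le_rfl (le_of_eq ?_)
    push_cast
    field_simp
    ring

/-! ### Lower densities of the groups `H n` -/

/-- The lower density of `G` is at least `1 - ε`. -/
def DensityGE (G : Subgroup AutT) (ε : ℝ) : Prop :=
  ∀ δ > ε, ∀ᶠ m in Filter.atTop, 1 - δ ≤ density G m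

theorem DensityGE.mono {G K : Subgroup AutT} {ε : ℝ} (h : DensityGE G ε) (hGK : G ≤ K) :
    DensityGE K ε := fun δ hδ => (h δ hδ).mono fun m hm => hm.trans (density_mono hGK m)

/-- The arguments of `delta` in the recursion for `bTilde n`. -/
def tildeArgs (n : ℕ) : List AutT := initArgs n ++ [bTilde (n + 1)]

theorem length_tildeArgs {n : ℕ} (hn : 3 ≤ n) : (tildeArgs n).length = n := by
  simp [tildeArgs, initArgs]
  omega

theorem H_eq {n : ℕ} (hn : 3 ≤ n) :
    H n = Subgroup.closure {a (tildeArgs n).length, delta (tildeArgs n)} := by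
  rw [length_tildeArgs hn, H, bTilde_rec]
  rfl

theorem H_succ_le (n : ℕ) : H (n + 1) ≤ Subgroup.closure {x | x ∈ tildeArgs n} := by
  refine (Subgroup.closure_le _).2 ?_
  rintro _ (rfl | rfl) <;> exact Subgroup.subset_closure (by simp [tildeArgs, initArgs])

theorem spinal_le (n : ℕ) : spinal (n - 3) ≤ Subgroup.closure {x | x ∈ tildeArgs n} := by
  refine (Subgroup.closure_le _).2 ?_
  rintro _ (rfl | ⟨i, hi, hi', rfl⟩)
  · exact Subgroup.subset_closure (by simp [tildeArgs, initArgs])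
  · refine Subgroup.subset_closure ?_
    have : b i (n - 3) ∈ (List.range (n - 3)).map fun i => b (i + 1) (n - 3) :=
      List.mem_map.2 ⟨i - 1, List.mem_range.2 (by omega), by rw [Nat.sub_add_cancel hi]⟩
    simp only [tildeArgs, initArgs, Set.mem_ofPred_eq, List.mem_append, List.cons_append,
      List.mem_cons]
    tauto

/-- The loss nm/2^m tends to 0 and the shift of levels by `n` does not affect a lower limit, so
nothing is lost in this step. -/
theorem densityGE_H_of_tildeArgs {n : ℕ} (hn : 3 ≤ n) {ε : ℝ}
    (h : DensityGE (Subgroup.closure {x | x ∈ tildeArgs n}) ε) : DensityGE (H n) ε := by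
  intro δ hδ
  have hlim : Filter.Tendsto (fun m : ℕ => ((m * n : ℕ) : ℝ) / 2 ^ m) Filter.atTop (nhds 0) := by
    have := (tendsto_pow_const_div_const_pow_of_one_lt 1 (one_lt_two (α := ℝ))).const_mul (n : ℝ)
    rw [mul_zero] at this
    refine this.congr fun m => ?_
    push_cast
    ring
  have h1 := h ((ε + δ) / 2) (by linarith)
  have h2 := hlim.eventually (gt_mem_nhds (show 0 < (δ - ε) / 2 by linarith))
  rw [← Filter.map_add_atTop_eq_nat n, Filter.eventually_map]
  filter_upwards [h1, h2] with m h1 h2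
  have h3 := stab_relIndex_closure_delta m (tildeArgs n)
  rw [← H_eq hn, length_tildeArgs hn] at h3
  have h4 := density_add_ge h3
  linarith

theorem densityGE_H_of_spinal {n : ℕ} (hn : 4 ≤ n) :
    DensityGE (H n) ((4 * (n - 3 : ℕ) + 9) / 2 ^ (n - 3 + 1)) := by
  refine densityGE_H_of_tildeArgs (by omega) (DensityGE.mono ?_ (spinal_le n))
  intro δ hδ
  filter_upwards [Filter.eventually_ge_atTop (n - 3 + 1)] with m hm
  have := spinal_density (N := n - 3) (by omega) hm
  linarith

theorem densityGE_H {n : ℕ} (hn : 3 ≤ n) : DensityGE (H n) 0 := by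
  have step : ∀ j ε, DensityGE (H (n + j)) ε → DensityGE (H n) ε := by
    intro j
    induction j with
    | zero => exact fun ε h => h
    | succ j ih => exact fun ε h => ih ε (densityGE_H_of_tildeArgs (by omega) (h.mono (H_succ_le (n + j))))
  have hlim : Filter.Tendsto (fun N : ℕ => ((4 * N + 9 : ℝ)) / 2 ^ (N + 1)) Filter.atTop
      (nhds 0) := by
    have h1 := (tendsto_pow_const_div_const_pow_of_one_lt 1 (one_lt_two (α := ℝ))).const_mul 2
    have h2 := (tendsto_pow_const_div_const_pow_of_one_lt 0 (one_lt_two (α := ℝ))).const_mul (9 / 2)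
    have := h1.add h2
    rw [mul_zero, mul_zero, add_zero] at this
    refine this.congr fun N => ?_
    rw [pow_succ]
    field_simp
    ring
  intro δ hδ
  obtain ⟨N, hN, hN'⟩ := ((hlim.eventually (gt_mem_nhds hδ)).and
    (Filter.eventually_ge_atTop n)).exists
  -- Descend from index N + 3, whose generators involve the spinal group with parameter N; N ≥ n
  -- keeps the subtraction exact.
  refine step (N + 3 - n) _ ?_ δ hN
  have := densityGE_H_of_spinal (n := N + 3) (by omega)
  rw [Nat.add_sub_cancel] at this
  rwa [Nat.add_sub_cancel' (by omega)]

/-- The dimension divides by 2^m - 1 rather than 2^m, which only raises the ratio; the order of Aut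
T on level `m` bounds it by 1. -/
theorem hausdorffDim_eq_one {G : Subgroup AutT} (h : DensityGE G 0) : hausdorffDim G = 1 := by
  refine Filter.Tendsto.liminf_eq ?_
  have hf : ∀ m : ℕ, Real.log (Nat.card (G ⧸ (stab m).subgroupOf G)) /
      Real.log (Nat.card (AutT ⧸ stab m)) =
      Real.logb 2 ((stab m).relIndex G) / (2 ^ m - 1) := fun m => by
    change Real.log ((stab m).relIndex G) / Real.log ((stab m).index) = _
    rw [stab_index, Nat.cast_pow, Real.log_pow, Nat.cast_sub Nat.one_le_two_pow, Real.logb]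
    push_cast
    rw [div_div, mul_comm]
  simp_rw [hf]
  have hpos : ∀ m : ℕ, 1 ≤ m → (0 : ℝ) < 2 ^ m - 1 := fun m hm =>
    sub_pos.2 (one_lt_pow₀ one_lt_two (by omega))
  refine tendsto_order.2 ⟨fun c hc => ?_, fun c hc => ?_⟩
  · filter_upwards [h ((1 - c) / 2) (by linarith), Filter.eventually_ge_atTop 1] with m h1 hm
    have h2 : density G m ≤ Real.logb 2 ((stab m).relIndex G) / (2 ^ m - 1) :=
      div_le_div_of_nonneg_left (Real.logb_nonneg one_lt_two
        (Nat.one_le_cast.2 (Nat.pos_of_ne_zero (stab_relIndex_ne_zero m G)))) (hpos m hm)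
        (by linarith)
    linarith
  · filter_upwards [Filter.eventually_ge_atTop 1] with m hm
    refine lt_of_le_of_lt ((div_le_one (hpos m hm)).2 ?_) hc
    have h1 := Real.logb_le_logb_of_le (b := 2) (y := (2 : ℝ) ^ (2 ^ m - 1)) one_lt_two
      (stab_relIndex_pos m G) (by exact_mod_cast stab_relIndex_le m G)
    rw [Real.logb_pow, Real.logb_self_eq_one one_lt_two, mul_one,
      Nat.cast_sub Nat.one_le_two_pow] at h1
    exact_mod_cast h1

end BinTree

theorem theorem6p5 (n : ℕ) (hn : 3 ≤ n) : BinTree.hausdorffDim (BinTree.H n) = 1 := by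
  exact BinTree.hausdorffDim_eq_one (BinTree.densityGE_H hn)
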